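/- Let $n, J\ge 0$ be integers, let $t_1\le t_2\le\dots\le t_{J+4}$ be a nondecreasing sequence of real knots, and let $B_1,\dots,B_J$ be the associated cubic B-splines (Cox–de Boor recursion, terms with zero denominator being $0$, the last nonempty knot interval being closed on the right). Let $x_1,\dots,x_n\in\mathbb{R}$ be fixed design points, let $\mathbf{B}\in\mathbb{R}^{n\times J}$ be the matrix $\mathbf{B}_{ij}=B_j(x_i)$, and assume that $\mathbf{B}$ has full column rank $J$. Let $\mathbf{y}=\mu+\epsilon$ with $\mu\in\mathbb{R}^n$ fixed and $\epsilon\sim N(0,\sigma^2 I_n)$, $\sigma>0$. For each $y\in\mathbb{R}^n$ there is a unique minimizer $\hat\gamma(y)$ of $(y-\mathbf{B}\gamma)^\top(y-\mathbf{B}\gamma)$ over all $\gamma\in\mathbb{R}^J$ with $\gamma_1\le\gamma_2\le\dots\le\gamma_J$. Let $\hat\mu(y)=\mathbf{B}\hat\gamma(y)$ be the monotone cubic B-spline fit and let $U_y$ be the number of distinct values among $\hat\gamma_1(y),\dots,\hat\gamma_J(y)$. Then each $\hat\mu_i(\mathbf{y})$ is square integrable, $U_{\mathbf{y}}$ is integrable,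 and the degrees of freedom of the fit satisfies $$\mathrm{df}(\hat\mu):=\frac{1}{\sigma^2}\sum_{i=1}^n\operatorname{Cov}\bigl(\hat\mu_i(\mathbf{y}),y_i\bigr)=\mathbb{E}[U_{\mathbf{y}}].$$ -/

import Mathlib

open MeasureTheory ProbabilityTheory
open scoped NNReal Matrix

noncomputable section

namespace MonoSpline

/-- `bspline t k j _ x` is the value at `x` of the `j`-th B-spline of degree `k` (order `k + 1`)
for the knots `t 0 ≤ t 1 ≤ … ≤ t (N - 1)`, given by the Cox-de Boor recursion with the usual
convention that a term with a vanishing denominator is zero. In degree zero it is the indicator of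
`[t j, t (j + 1))`; the last nonempty knot interval is closed on the right as usual, so that the
basis functions also sum to one at the right end point of the spline domain. -/
def bspline {N : ℕ} (t : Fin N → ℝ) : (k j : ℕ) → (h : j + k + 1 < N) → ℝ → ℝ
  | 0, j, h, x =>
      open Classical in
      if t ⟨j, by omega⟩ ≤ x ∧
          (x < t ⟨j + 1, by omega⟩ ∨
            (x = t ⟨j + 1, by omega⟩ ∧ t ⟨j, by omega⟩ < t ⟨j + 1, by omega⟩ ∧
              t ⟨j + 1, by omega⟩ = t ⟨N - 1, by omega⟩))
      then 1 else 0
  | k + 1, j, h, x =>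
      (x - t ⟨j, by omega⟩) / (t ⟨j + k + 1, by omega⟩ - t ⟨j, by omega⟩) *
          bspline t k j (by omega) x +
        (t ⟨j + k + 2, by omega⟩ - x) / (t ⟨j + k + 2, by omega⟩ - t ⟨j + 1, by omega⟩) *
          bspline t k (j + 1) (by omega) x

/-- The `J` cubic B-splines on `J + 4` knots. -/
def cubicBSpline {J : ℕ} (t : Fin (J + 4) → ℝ) (j : Fin J) : ℝ → ℝ :=
  bspline t 3 j (by omega)

/-- The `n × J` matrix with entries `B_j (x_i)`. -/
def splineMatrix {n J : ℕ} (t : Fin (J + 4) → ℝ) (x : Fin n → ℝ) : Matrix (Fin n) (Fin J) ℝ :=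
  Matrix.of fun i j => cubicBSpline t j (x i)

/-- The residual sum of squares `(y - B γ)ᵀ (y - B γ)`. -/
def rss {n J : ℕ} (B : Matrix (Fin n) (Fin J) ℝ) (y : Fin n → ℝ) (γ : Fin J → ℝ) : ℝ :=
  (y - B *ᵥ γ) ⬝ᵥ (y - B *ᵥ γ)

/-- `γ` minimizes the residual sum of squares among the vectors with `γ₁ ≤ … ≤ γ_J`. -/
def IsMonotoneFit {n J : ℕ} (B : Matrix (Fin n) (Fin J) ℝ) (y : Fin n → ℝ)
    (γ : Fin J → ℝ) : Prop :=
  Monotone γ ∧ ∀ γ' : Fin J → ℝ, Monotone γ' → rss B y γ ≤ rss B y γ'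

/-- The fitted coefficients: a minimizer of the monotone least squares problem. -/
def monoCoef {n J : ℕ} (B : Matrix (Fin n) (Fin J) ℝ) (y : Fin n → ℝ) : Fin J → ℝ :=
  Classical.epsilon (IsMonotoneFit B y)

/-- The fitted vector `B γ̂`. -/
def monoFit {n J : ℕ} (B : Matrix (Fin n) (Fin J) ℝ) (y : Fin n → ℝ) : Fin n → ℝ :=
  B *ᵥ monoCoef B y

/-- The number of distinct fitted coefficients. -/
def numDistinctCoef {n J : ℕ} (B : Matrix (Fin n) (Fin J) ℝ) (y : Fin n → ℝ) : ℕ :=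
  (Set.range (monoCoef B y)).ncard

/-- The degrees of freedom `σ⁻² ∑ i, Cov (μ̂ (Y) i, Y i)` of a fitting method `μ̂ : ℝⁿ → ℝⁿ`. -/
def degreesOfFreedom {Ω : Type*} [MeasurableSpace Ω] (P : Measure Ω) {n : ℕ}
    (Y : Ω → Fin n → ℝ) (σ : ℝ) (fit : (Fin n → ℝ) → Fin n → ℝ) : ℝ :=
  1 / σ ^ 2 * ∑ i, cov[fun ω => fit (Y ω) i, fun ω => Y ω i; P]

end MonoSpline

end

open Filter Topology
open scoped InnerProductSpace

/-! The fit is the metric projection of `y` onto the closed convex cone of all `B γ` with `γ`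
monotone, so it is nonexpansive in the Euclidean norm. Stein's identity for Lipschitz functions then
gives `Cov (μ̂ i, y i) = σ² E[∂ᵢ μ̂ i]`, and the degrees of freedom become the expected divergence
of the fit.

To compute the divergence, fix the set of tied coefficient pairs. Where this set is constant, the
fit coincides with the linear orthogonal projection onto the image under `B` of the vectors with
those ties (`IsConeFit.eq_tiedProj`). There are finitely many measurable tie patterns, and a
Lipschitz map has at almost every point of a piece the derivative of the linear map it equals there.
So the divergence is almost everywhere the trace of a projection, i.e. its rank, which is the number
of distinct coefficients because `B` is injective (`sum_inner_tiedProj`). -/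

/-! ### Gaussian integration by parts for Lipschitz functions -/

theorem memLp_of_lipschitzWith_gaussianReal {f : ℝ → ℝ} {C : ℝ≥0} (hf : LipschitzWith C f)
    (m : ℝ) (v : ℝ≥0) : MemLp f 2 (gaussianReal m v) := by
  have hid : MemLp (fun s : ℝ => s) 2 (gaussianReal m v) := memLp_id_gaussianReal' 2 (by simp)
  have hbd : MemLp (fun s : ℝ => |f 0| + C * ‖s‖) 2 (gaussianReal m v) :=
    (memLp_const |f 0|).add (hid.norm.const_mul (C : ℝ))
  refine hbd.mono' hf.continuous.aestronglyMeasurable (ae_of_all _ fun s => ?_)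
  have h1 := hf.dist_le_mul s 0
  simp only [Real.dist_eq, sub_zero] at h1
  have h2 := abs_sub_abs_le_abs_sub (f s) (f 0)
  rw [Real.norm_eq_abs, Real.norm_eq_abs]
  linarith

theorem integrable_gaussianReal_iff {f : ℝ → ℝ} (m : ℝ) {v : ℝ≥0} (hv : v ≠ 0) :
    Integrable f (gaussianReal m v) ↔ Integrable fun s => gaussianPDFReal m v s * f s := by
  rw [gaussianReal_of_var_ne_zero _ hv, integrable_withDensity_iff_integrable_smul'
    (measurable_gaussianPDF _ _) (ae_of_all _ fun _ => gaussianPDF_lt_top)]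
  simp [toReal_gaussianPDF]

theorem hasDerivAt_gaussianPDFReal (m : ℝ) (v : ℝ≥0) (s : ℝ) :
    HasDerivAt (gaussianPDFReal m v) (gaussianPDFReal m v s * (-(s - m) / v)) s := by
  have h : HasDerivAt (fun s : ℝ => -(s - m) ^ 2 / (2 * v)) (-(s - m) / v) s := by
    have := ((((hasDerivAt_id s).sub_const m).pow 2).neg).div_const (2 * (v : ℝ))
    convert! this using 1
    simp
    ring
  have := (h.exp).const_mul ((√(2 * Real.pi * v))⁻¹)
  rw [gaussianPDFReal_def]
  convert! this using 1
  ring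

/-- Stein's identity in one dimension. -/
theorem integral_sub_mul_gaussianReal_of_lipschitzWith {f : ℝ → ℝ} {C : ℝ≥0}
    (hf : LipschitzWith C f) (m : ℝ) {v : ℝ≥0} (hv : v ≠ 0) :
    ∫ s, (s - m) * f s ∂(gaussianReal m v) = v * ∫ s, deriv f s ∂(gaussianReal m v) := by
  set φ := gaussianPDFReal m v with hφ
  have hφd : ∀ s, deriv φ s = φ s * (-(s - m) / v) :=
    fun s => (hasDerivAt_gaussianPDFReal m v s).deriv
  have hfL := memLp_of_lipschitzWith_gaussianReal hf m v
  have hsL : MemLp (fun s : ℝ => s - m) 2 (gaussianReal m v) :=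
    (memLp_id_gaussianReal' 2 (by simp)).sub (memLp_const m)
  have i0 : Integrable fun s => φ s * f s :=
    (integrable_gaussianReal_iff m hv).1 (hfL.integrable (by simp))
  have i1 : Integrable fun s => φ s * ((s - m) * f s) :=
    (integrable_gaussianReal_iff m hv).1 (hsL.integrable_mul hfL)
  have i2 : Integrable fun s => φ s * deriv f s := by
    refine (integrable_gaussianReal_iff m hv).1 ?_
    refine Integrable.of_bound (measurable_deriv f).aestronglyMeasurable C (ae_of_all _ fun s => ?_)
    exact norm_deriv_le_of_lipschitz hf
  have i3 : Integrable fun s => f s * deriv φ s := by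
    refine (i1.const_mul (-(v : ℝ)⁻¹)).congr (ae_of_all _ fun s => ?_)
    simp only [hφd]
    ring
  have hint : Integrable fun s => deriv f s * φ s + f s * deriv φ s :=
    (i2.congr (ae_of_all _ fun s => mul_comm _ _)).add i3
  have hφc : ContDiff ℝ 1 φ := by
    rw [hφ, gaussianPDFReal_def]
    fun_prop
  -- `f` is only almost everywhere differentiable, so integration by parts uses absolute continuity
  -- on `[-R, R]`.
  have hibp : ∀ R : ℝ, ∫ s in -R..R, deriv f s * φ s + f s * deriv φ s
      = f R * φ R - f (-R) * φ (-R) := fun R =>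
    AbsolutelyContinuousOnInterval.integral_deriv_mul_eq_sub
      hf.lipschitzOnWith.absolutelyContinuousOnInterval
      hφc.contDiffOn.absolutelyContinuousOnInterval
  have hlim := intervalIntegral_tendsto_integral hint tendsto_neg_atTop_atBot tendsto_id
  simp only [id, hibp] at hlim
  -- The boundary term converges as `R → ∞` and is integrable in `R`. Since neighbourhoods of
  -- infinity have infinite measure, its limit must be zero; no decay estimate is needed.
  have hzero : ∫ s, (deriv f s * φ s + f s * deriv φ s) = 0 := by
    refine IntegrableAtFilter.eq_zero_of_tendsto (μ := volume)
      (f := fun R : ℝ => f R * φ R - f (-R) * φ (-R)) (l := atTop) ?_ ?_ hlim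
    · have i0' : Integrable fun s => f s * φ s := i0.congr (ae_of_all _ fun s => mul_comm _ _)
      exact (i0'.sub i0'.comp_neg).integrableAtFilter _
    · intro s hs
      obtain ⟨a, ha⟩ := mem_atTop_sets.1 hs
      exact measure_mono_top (fun x hx => ha x hx) (Real.volume_Ici (a := a))
  rw [integral_add (i2.congr (ae_of_all _ fun s => mul_comm _ _)) i3] at hzero
  rw [integral_gaussianReal_eq_integral_smul hv, integral_gaussianReal_eq_integral_smul hv]
  simp only [smul_eq_mul, ← hφ]
  have e1 : ∫ s, f s * deriv φ s = -(v : ℝ)⁻¹ * ∫ s, φ s * ((s - m) * f s) := by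
    rw [← integral_const_mul]
    congr with s
    simp only [hφd]
    ring
  have e2 : ∫ s, deriv f s * φ s = ∫ s, φ s * deriv f s := by
    congr with s
    ring
  rw [e1, e2] at hzero
  have hv' : (v : ℝ) ≠ 0 := by exact_mod_cast hv
  have : ∫ s, φ s * deriv f s = (v : ℝ)⁻¹ * ∫ s, φ s * ((s - m) * f s) := by linarith
  rw [this, ← mul_assoc, mul_inv_cancel₀ hv', one_mul]

theorem memLp_eval_pi_gaussianReal {n : ℕ} (μ : Fin n → ℝ) (v : ℝ≥0) (i : Fin n) :
    MemLp (fun y : Fin n → ℝ => y i) 2 (Measure.pi fun i => gaussianReal (μ i) v) :=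
  (memLp_id_gaussianReal' (μ := μ i) (v := v) 2 (by simp)).comp_measurePreserving
    (measurePreserving_eval (fun i => gaussianReal (μ i) v) i)

theorem memLp_of_lipschitzWith_pi_gaussianReal {n : ℕ} {F : (Fin n → ℝ) → ℝ} {C : ℝ≥0}
    (hF : LipschitzWith C F) (μ : Fin n → ℝ) (v : ℝ≥0) :
    MemLp F 2 (Measure.pi fun i => gaussianReal (μ i) v) := by
  have hsum : MemLp (fun y : Fin n → ℝ => ∑ i, ‖y i‖) 2
      (Measure.pi fun i => gaussianReal (μ i) v) :=
    memLp_finsetSum _ fun i _ => (memLp_eval_pi_gaussianReal μ v i).norm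
  have hbd : MemLp (fun y : Fin n → ℝ => |F 0| + C * ∑ i, ‖y i‖) 2
      (Measure.pi fun i => gaussianReal (μ i) v) :=
    (memLp_const |F 0|).add (hsum.const_mul (C : ℝ))
  refine hbd.mono' hF.continuous.aestronglyMeasurable (ae_of_all _ fun y => ?_)
  have h1 := hF.dist_le_mul y 0
  rw [dist_zero_right, Real.dist_eq] at h1
  have h2 := abs_sub_abs_le_abs_sub (F y) (F 0)
  have h3 : (C : ℝ) * ‖y‖ ≤ C * ∑ i, ‖y i‖ := by
    refine mul_le_mul_of_nonneg_left ?_ C.2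
    refine (pi_norm_le_iff_of_nonneg (Finset.sum_nonneg fun i _ => norm_nonneg _)).2 fun i => ?_
    exact Finset.single_le_sum (f := fun i => ‖y i‖) (fun i _ => norm_nonneg _) (Finset.mem_univ i)
  rw [Real.norm_eq_abs]
  linarith

theorem integrable_lineDeriv_pi_gaussianReal {n : ℕ} {F : (Fin n → ℝ) → ℝ} {C : ℝ≥0}
    (hF : LipschitzWith C F) (μ : Fin n → ℝ) (v : ℝ≥0) (e : Fin n → ℝ) :
    Integrable (fun y => lineDeriv ℝ F y e) (Measure.pi fun i => gaussianReal (μ i) v) :=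
  (hF.memLp_lineDeriv e).integrable (by simp)

/-- Stein's identity for a Lipschitz function of independent Gaussian variables. -/
theorem integral_sub_mul_pi_gaussianReal_of_lipschitzWith {n : ℕ} {F : (Fin n → ℝ) → ℝ} {C : ℝ≥0}
    (hF : LipschitzWith C F) (μ : Fin n → ℝ) {v : ℝ≥0} (hv : v ≠ 0) (i : Fin n) :
    ∫ y, (y i - μ i) * F y ∂(Measure.pi fun i => gaussianReal (μ i) v) =
      v * ∫ y, lineDeriv ℝ F y (Pi.single i 1) ∂(Measure.pi fun i => gaussianReal (μ i) v) := by
  obtain _ | m := n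
  · exact i.elim0
  have hmp := (measurePreserving_piFinSuccAbove (fun i => gaussianReal (μ i) v) i).symm
  set e := MeasurableEquiv.piFinSuccAbove (fun _ : Fin (m + 1) => ℝ) i
  have he : ∀ p : ℝ × (Fin m → ℝ), e.symm p = i.insertNth p.1 p.2 := fun p => rfl
  have hI1 : Integrable (fun y : Fin (m + 1) → ℝ => (y i - μ i) * F y)
      (Measure.pi fun i => gaussianReal (μ i) v) :=
    ((memLp_eval_pi_gaussianReal μ v i).sub (memLp_const (μ i))).integrable_mul
      (memLp_of_lipschitzWith_pi_gaussianReal hF μ v)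
  have hI2 := integrable_lineDeriv_pi_gaussianReal hF μ v (Pi.single i 1)
  -- Fubini with coordinate `i` innermost: for fixed remaining coordinates `z`, the one-dimensional
  -- identity applies.
  rw [← hmp.integral_comp' (g := fun y => (y i - μ i) * F y),
    ← hmp.integral_comp' (g := fun y => lineDeriv ℝ F y (Pi.single i 1)),
    integral_prod_symm (fun p => (e.symm p i - μ i) * F (e.symm p))
      (hmp.integrable_comp_of_integrable hI1),
    integral_prod_symm (fun p => lineDeriv ℝ F (e.symm p) (Pi.single i 1))
      (hmp.integrable_comp_of_integrable hI2), ← integral_const_mul]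
  congr with z
  have hins : ∀ s r : ℝ, (i.insertNth s z : Fin (m + 1) → ℝ) + r • Pi.single i 1
      = i.insertNth (s + r) z := fun s r => by
    ext j
    refine Fin.succAboveCases i ?_ (fun k => ?_) j <;> simp
  have hlip : LipschitzWith C fun s : ℝ => F (i.insertNth s z) := by
    have h1 : LipschitzWith 1 fun s : ℝ => (i.insertNth s z : Fin (m + 1) → ℝ) := by
      refine LipschitzWith.of_dist_le_mul fun s r => ?_
      rw [NNReal.coe_one, one_mul]
      refine (dist_pi_le_iff dist_nonneg).2 fun j => ?_
      refine Fin.succAboveCases i ?_ (fun k => ?_) j <;> simp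
    simpa [Function.comp_def] using hF.comp h1
  have key := integral_sub_mul_gaussianReal_of_lipschitzWith hlip (μ i) hv
  simp only [he, Fin.insertNth_apply_same, lineDeriv, hins]
  rw [key]
  congr with s
  rw [deriv_comp_const_add (f := fun s => F (i.insertNth s z)), add_zero]

/-! ### Projection onto the image of the monotone cone -/

namespace MonoSpline

section Cone

variable {ι E : Type*} [Fintype ι] [Preorder ι] [NormedAddCommGroup E] [InnerProductSpace ℝ E]

/-- The pairs of indices at which two coordinates of `γ` agree. -/
def ties (γ : ι → ℝ) : Set (ι × ι) := {p | γ p.1 = γ p.2}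

/-- The vectors whose coordinates agree at each pair in `s`. -/
def tiedSubspace (s : Set (ι × ι)) : Submodule ℝ (ι → ℝ) where
  carrier := {γ | ∀ p ∈ s, γ p.1 = γ p.2}
  add_mem' ha hb p hp := by simp [ha p hp, hb p hp]
  zero_mem' p hp := rfl
  smul_mem' c a ha p hp := by simp [ha p hp]

omit [Fintype ι] [Preorder ι] in
theorem mem_tiedSubspace {s : Set (ι × ι)} {γ : ι → ℝ} :
    γ ∈ tiedSubspace s ↔ ∀ p ∈ s, γ p.1 = γ p.2 := Iff.rfl

omit [Preorder ι] in
-- Vectors tied wherever `γ` is tied are those factoring through `γ`, hence arbitrary functions on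
-- its range.
theorem finrank_tiedSubspace_ties (γ : ι → ℝ) :
    Module.finrank ℝ (tiedSubspace (ties γ)) = (Set.range γ).ncard := by
  classical
  have hfin : Fintype (Set.range γ) := (Set.finite_range γ).fintype
  set F : (Set.range γ → ℝ) →ₗ[ℝ] (ι → ℝ) := LinearMap.funLeft ℝ ℝ (Set.rangeFactorization γ)
  have hF : Function.Injective F :=
    LinearMap.funLeft_injective_of_surjective _ _ _ Set.rangeFactorization_surjective
  have hr : LinearMap.range F = tiedSubspace (ties γ) := by
    ext δ
    rw [LinearMap.mem_range, mem_tiedSubspace]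
    constructor
    · rintro ⟨g, rfl⟩ p hp
      have : Set.rangeFactorization γ p.1 = Set.rangeFactorization γ p.2 := Subtype.ext hp
      simp [F, LinearMap.funLeft_apply, this]
    · intro h
      refine ⟨fun a => δ a.2.choose, ?_⟩
      ext j
      have := (Set.rangeFactorization γ j).2.choose_spec
      exact h (_, j) this
  rw [← hr, LinearMap.finrank_range_of_inj hF, Module.finrank_fintype_fun_eq_card,
    ← Nat.card_eq_fintype_card, Nat.card_coe_set_eq]

/-- `γ` satisfies the variational inequality of the projection of `u` onto the image under `T` of
the cone of monotone vectors. -/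
def IsConeFit (T : (ι → ℝ) →ₗ[ℝ] E) (u : E) (γ : ι → ℝ) : Prop :=
  Monotone γ ∧ ∀ δ : ι → ℝ, Monotone δ → ⟪u - T γ, T δ - T γ⟫_ℝ ≤ 0

omit [Fintype ι] in
-- Test each variational inequality at the other fit, add the two, and apply Cauchy–Schwarz.
theorem IsConeFit.norm_sub_le {T : (ι → ℝ) →ₗ[ℝ] E} {u w : E} {γ δ : ι → ℝ}
    (h₁ : IsConeFit T u γ) (h₂ : IsConeFit T w δ) : ‖T γ - T δ‖ ≤ ‖u - w‖ := by
  have a := h₁.2 δ h₂.1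
  have b := h₂.2 γ h₁.1
  have e : ⟪u - T γ, T δ - T γ⟫_ℝ + ⟪w - T δ, T γ - T δ⟫_ℝ
      = ‖T γ - T δ‖ ^ 2 - ⟪u - w, T γ - T δ⟫_ℝ := by
    rw [← real_inner_self_eq_norm_sq, ← neg_sub (T γ) (T δ), inner_neg_right, ← sub_eq_neg_add,
      ← inner_sub_left, ← inner_sub_left]
    congr 1
    abel
  have c := real_inner_le_norm (u - w) (T γ - T δ)
  by_contra! hlt
  have := norm_nonneg (u - w)
  nlinarith

omit [Fintype ι] in
theorem IsConeFit.unique {T : (ι → ℝ) →ₗ[ℝ] E} (hT : Function.Injective T) {u : E} {γ δ : ι → ℝ}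
    (h₁ : IsConeFit T u γ) (h₂ : IsConeFit T u δ) : γ = δ := by
  have := h₁.norm_sub_le h₂
  rw [sub_self, norm_zero, norm_le_zero_iff, sub_eq_zero] at this
  exact hT this

omit [Fintype ι] in
theorem convex_setOf_monotone : Convex ℝ {γ : ι → ℝ | Monotone γ} := by
  intro a ha b hb s t hs ht _ i j hij
  have h1 := mul_le_mul_of_nonneg_left (ha hij) hs
  have h2 := mul_le_mul_of_nonneg_left (hb hij) ht
  simpa using add_le_add h1 h2

omit [Fintype ι] in
theorem isClosed_setOf_monotone : IsClosed {γ : ι → ℝ | Monotone γ} := by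
  simp only [Monotone, Set.ofPred_forall]
  exact isClosed_iInter fun i => isClosed_iInter fun j => isClosed_iInter fun _ =>
    isClosed_le (continuous_apply i) (continuous_apply j)

omit [Fintype ι] in
theorem isConeFit_iff (T : (ι → ℝ) →ₗ[ℝ] E) (u : E) (γ : ι → ℝ) :
    IsConeFit T u γ ↔ Monotone γ ∧ ∀ δ : ι → ℝ, Monotone δ → ‖u - T γ‖ ≤ ‖u - T δ‖ := by
  set K : Set E := T '' {γ | Monotone γ}
  have hconv : Convex ℝ K := convex_setOf_monotone.linear_image T
  refine and_congr_right fun hγ => ?_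
  have hmem : T γ ∈ K := Set.mem_image_of_mem T hγ
  have h1 := norm_eq_iInf_iff_real_inner_le_zero hconv (u := u) hmem
  have hbdd : BddBelow (Set.range fun w : K => ‖u - w‖) :=
    ⟨0, by rintro _ ⟨w, rfl⟩; exact norm_nonneg _⟩
  have : Nonempty K := ⟨⟨_, hmem⟩⟩
  have h2 : (∀ w ∈ K, ⟪u - T γ, w - T γ⟫_ℝ ≤ 0) ↔
      ∀ δ : ι → ℝ, Monotone δ → ⟪u - T γ, T δ - T γ⟫_ℝ ≤ 0 := by
    simp [K]
  rw [← h2, ← h1]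
  constructor
  · intro h δ hδ
    rw [h]
    exact ciInf_le hbdd (⟨T δ, Set.mem_image_of_mem T hδ⟩ : K)
  · intro h
    refine le_antisymm (le_ciInf ?_) (ciInf_le hbdd (⟨T γ, hmem⟩ : K))
    rintro ⟨_, δ, hδ, rfl⟩
    exact h δ hδ

theorem exists_isConeFit [FiniteDimensional ℝ E] {T : (ι → ℝ) →ₗ[ℝ] E} (hT : Function.Injective T) (u : E) :
    ∃ γ, IsConeFit T u γ := by
  set K : Set E := T '' {γ | Monotone γ}
  have hconv : Convex ℝ K := convex_setOf_monotone.linear_image T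
  -- Injectivity makes `T` a closed embedding, so the image of the closed cone is closed.
  have hcomp : IsComplete K := by
    have hT' := T.isClosedEmbedding_of_injective (LinearMap.ker_eq_bot.2 hT)
    exact (hT'.isClosedMap _ isClosed_setOf_monotone).isComplete
  obtain ⟨_, ⟨γ, hγ, rfl⟩, h⟩ :=
    exists_norm_eq_iInf_of_complete_convex (Set.Nonempty.image T ⟨0, monotone_const⟩) hcomp hconv u
  refine ⟨γ, hγ, fun δ hδ => ?_⟩
  exact (norm_eq_iInf_iff_real_inner_le_zero hconv (Set.mem_image_of_mem T hγ)).1 h _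
    (Set.mem_image_of_mem T hδ)

/-- Strict inequalities survive small perturbations, and ties of `γ` persist because `δ` shares
them. Both signs of `c` are thus admissible, which turns the variational inequality into an
orthogonality relation. -/
theorem eventually_monotone_add_smul {γ δ : ι → ℝ} (hγ : Monotone γ)
    (hδ : δ ∈ tiedSubspace (ties γ)) : ∀ᶠ c : ℝ in 𝓝 0, Monotone (γ + c • δ) := by
  have h : ∀ p : ι × ι, ∀ᶠ c : ℝ in 𝓝 0, p.1 ≤ p.2 → (γ + c • δ) p.1 ≤ (γ + c • δ) p.2 := by
    rintro ⟨i, j⟩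
    by_cases hij : i ≤ j
    · rcases (hγ hij).eq_or_lt with he | hlt
      · have := hδ (i, j) he
        refine Eventually.of_forall fun c _ => ?_
        simp only at this
        simp [he, this]
      · have hc : ∀ k, Tendsto (fun c : ℝ => (γ + c • δ) k) (𝓝 0) (𝓝 (γ k)) := fun k => by
          have : Continuous fun c : ℝ => γ k + c * δ k := by fun_prop
          simpa using this.tendsto 0
        filter_upwards [(hc i).eventually_lt (hc j) hlt] with c hc _ using hc.le
    · exact Eventually.of_forall fun c h => absurd h hij
  filter_upwards [eventually_all.2 h] with c hc i j hij using hc (i, j) hij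

theorem IsConeFit.inner_eq_zero {T : (ι → ℝ) →ₗ[ℝ] E} {u : E} {γ δ : ι → ℝ}
    (h : IsConeFit T u γ) (hδ : δ ∈ tiedSubspace (ties γ)) : ⟪u - T γ, T δ⟫_ℝ = 0 := by
  have h1 := eventually_monotone_add_smul h.1 hδ
  obtain ⟨ε, hε, hball⟩ := Metric.eventually_nhds_iff.1 h1
  have key : ∀ c : ℝ, |c| < ε → c * ⟪u - T γ, T δ⟫_ℝ ≤ 0 := fun c hc => by
    have := h.2 _ (hball (y := c) (by simpa using hc))
    simpa [inner_smul_right] using this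
  have a := key (ε / 2) (by rw [abs_of_pos (by positivity)]; linarith)
  have b := key (-(ε / 2)) (by rw [abs_neg, abs_of_pos (by positivity)]; linarith)
  nlinarith

/-- The orthogonal projection onto the image under `T` of the vectors tied at the pairs in `s`. -/
noncomputable def tiedProj (T : (ι → ℝ) →ₗ[ℝ] E) (s : Set (ι × ι)) : E →L[ℝ] E :=
  ((tiedSubspace s).map T).starProjection

theorem IsConeFit.eq_tiedProj {T : (ι → ℝ) →ₗ[ℝ] E} {u : E} {γ : ι → ℝ}
    (h : IsConeFit T u γ) : T γ = tiedProj T (ties γ) u := by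
  refine (Submodule.eq_starProjection_of_mem_of_inner_eq_zero ?_ ?_).symm
  · exact Submodule.mem_map_of_mem fun p hp => hp
  · rintro _ ⟨δ, hδ, rfl⟩
    exact h.inner_eq_zero hδ

omit [Preorder ι] in
-- The trace of a projection is the dimension of its range, and the injective `T` preserves the
-- dimension of the tied subspace.
theorem sum_inner_tiedProj {κ : Type*} [Fintype κ] (b : OrthonormalBasis κ ℝ E)
    {T : (ι → ℝ) →ₗ[ℝ] E} (hT : Function.Injective T) (γ : ι → ℝ) :
    ∑ i, ⟪b i, tiedProj T (ties γ) (b i)⟫_ℝ = (Set.range γ).ncard := by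
  have : FiniteDimensional ℝ E := b.toBasis.finiteDimensional_of_finite
  have hp : LinearMap.IsProj ((tiedSubspace (ties γ)).map T)
      (tiedProj T (ties γ)).toLinearMap :=
    ⟨fun x => Submodule.starProjection_apply_mem _ x,
      fun x hx => Submodule.starProjection_eq_self_iff.2 hx⟩
  have h1 := LinearMap.trace_eq_sum_inner (tiedProj T (ties γ)).toLinearMap b
  rw [hp.trace, ← (Submodule.equivMapOfInjective T hT _).finrank_eq, finrank_tiedSubspace_ties] at h1
  exact h1.symm

end Cone

end MonoSpline

/-! ### Almost everywhere derivatives and absolute continuity -/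

/-- A Lipschitz function that agrees with one of countably many linear maps on each piece of a
measurable partition has that linear map as its derivative almost everywhere. -/
theorem LipschitzWith.ae_hasFDerivAt_of_piecewise_linear {V κ : Type*} [NormedAddCommGroup V]
    [NormedSpace ℝ V] [FiniteDimensional ℝ V] [MeasurableSpace V] [BorelSpace V] [Countable κ]
    (ν : Measure V) [ν.IsAddHaarMeasure] {f : V → V} {C : ℝ≥0} (hf : LipschitzWith C f)
    (A : κ → V →L[ℝ] V) (pat : V → κ) (hpat : ∀ k, MeasurableSet {u | pat u = k})
    (h : ∀ u, f u = A (pat u) u) : ∀ᵐ u ∂ν, HasFDerivAt f (A (pat u)) u := by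
  have hdiff := hf.ae_differentiableAt (μ := ν)
  have key : ∀ k, ∀ᵐ u ∂ν, u ∈ {u | pat u = k} ∩ {u | DifferentiableAt ℝ f u} →
      fderiv ℝ f u = A k := fun k => by
    have hs : MeasurableSet ({u | pat u = k} ∩ {u | DifferentiableAt ℝ f u}) :=
      (hpat k).inter (measurableSet_of_differentiableAt ℝ f)
    -- On one piece the increments of `f` are exactly those of `A k`, so the approximation constant
    -- is `0` and the derivative equals `A k` at almost every point of the piece.
    have happ : ApproximatesLinearOn f (A k)
        ({u | pat u = k} ∩ {u | DifferentiableAt ℝ f u}) 0 := by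
      rintro a ⟨ha, -⟩ b ⟨hb, -⟩
      simp only [Set.mem_ofPred_eq] at ha hb
      simp [h a, h b, ha, hb]
    have := happ.norm_fderiv_sub_le ν hs (fun u => fderiv ℝ f u)
      fun u hu => hu.2.hasFDerivAt.hasFDerivWithinAt
    filter_upwards [(ae_restrict_iff' hs).1 this] with u hu hmem
    simpa [sub_eq_zero] using hu hmem
  filter_upwards [hdiff, ae_all_iff.2 key] with u hu hk
  rw [← hk (pat u) ⟨rfl, hu⟩]
  exact hu.hasFDerivAt

theorem MeasureTheory.Measure.pi_fin_absolutelyContinuous {n : ℕ} {α : Type*} [MeasurableSpace α]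
    {μ ν : Fin n → Measure α} [∀ i, SigmaFinite (μ i)] [∀ i, SigmaFinite (ν i)]
    (h : ∀ i, μ i ≪ ν i) : Measure.pi μ ≪ Measure.pi ν := by
  induction n with
  | zero => rw [Measure.pi_of_empty μ, Measure.pi_of_empty ν]
  | succ n ih =>
    have hμ := (measurePreserving_piFinSuccAbove μ 0).symm
    have hν := (measurePreserving_piFinSuccAbove ν 0).symm
    rw [← hμ.map_eq, ← hν.map_eq]
    exact ((h 0).prod (ih fun i => h _)).map hμ.measurable

/-! ### The monotone least squares fit and its divergence -/

namespace MonoSpline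

variable {n J : ℕ}

/-- The linear map `γ ↦ B γ` into Euclidean space. -/
noncomputable def euclideanMulVec (B : Matrix (Fin n) (Fin J) ℝ) :
    (Fin J → ℝ) →ₗ[ℝ] EuclideanSpace ℝ (Fin n) :=
  (EuclideanSpace.equiv (Fin n) ℝ).symm.toLinearMap ∘ₗ B.mulVecLin

theorem equiv_euclideanMulVec (B : Matrix (Fin n) (Fin J) ℝ) (γ : Fin J → ℝ) :
    EuclideanSpace.equiv (Fin n) ℝ (euclideanMulVec B γ) = B *ᵥ γ := rfl

theorem euclideanMulVec_injective {B : Matrix (Fin n) (Fin J) ℝ} (hB : LinearIndependent ℝ B.col) :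
    Function.Injective (euclideanMulVec B) :=
  (EuclideanSpace.equiv (Fin n) ℝ).symm.injective.comp (Matrix.mulVec_injective_iff.2 hB)

theorem rss_eq_norm_sq (B : Matrix (Fin n) (Fin J) ℝ) (y : Fin n → ℝ) (γ : Fin J → ℝ) :
    rss B y γ = ‖(EuclideanSpace.equiv (Fin n) ℝ).symm y - euclideanMulVec B γ‖ ^ 2 := by
  rw [EuclideanSpace.real_norm_sq_eq, rss, dotProduct]
  refine Finset.sum_congr rfl fun i _ => ?_
  rw [sq]
  rfl

theorem isMonotoneFit_iff (B : Matrix (Fin n) (Fin J) ℝ) (y : Fin n → ℝ) (γ : Fin J → ℝ) :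
    IsMonotoneFit B y γ ↔
      IsConeFit (euclideanMulVec B) ((EuclideanSpace.equiv (Fin n) ℝ).symm y) γ := by
  rw [isConeFit_iff, IsMonotoneFit]
  simp only [rss_eq_norm_sq, sq_le_sq₀ (norm_nonneg _) (norm_nonneg _)]

theorem existsUnique_isMonotoneFit {B : Matrix (Fin n) (Fin J) ℝ}
    (hB : LinearIndependent ℝ B.col) (y : Fin n → ℝ) : ∃! γ, IsMonotoneFit B y γ := by
  simp only [isMonotoneFit_iff]
  obtain ⟨γ, hγ⟩ := exists_isConeFit (euclideanMulVec_injective hB)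
    ((EuclideanSpace.equiv (Fin n) ℝ).symm y)
  exact ⟨γ, hγ, fun δ hδ => hδ.unique (euclideanMulVec_injective hB) hγ⟩

theorem isConeFit_monoCoef {B : Matrix (Fin n) (Fin J) ℝ}
    (hB : LinearIndependent ℝ B.col) (y : Fin n → ℝ) :
    IsConeFit (euclideanMulVec B) ((EuclideanSpace.equiv (Fin n) ℝ).symm y) (monoCoef B y) :=
  (isMonotoneFit_iff B y _).1 (Classical.epsilon_spec (existsUnique_isMonotoneFit hB y).exists)

/-- The constant is `1` in the Euclidean norm; passing to and from the sup norm on `Fin n → ℝ`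
changes it, and only its existence matters. -/
theorem exists_lipschitzWith_monoFit {B : Matrix (Fin n) (Fin J) ℝ}
    (hB : LinearIndependent ℝ B.col) : ∃ C, LipschitzWith C (monoFit B) := by
  set e := EuclideanSpace.equiv (Fin n) ℝ
  have h : LipschitzWith 1 fun u : EuclideanSpace ℝ (Fin n) =>
      euclideanMulVec B (monoCoef B (e u)) := by
    refine LipschitzWith.of_dist_le_mul fun u w => ?_
    rw [NNReal.coe_one, one_mul, dist_eq_norm, dist_eq_norm]
    simpa [e] using (isConeFit_monoCoef hB (e u)).norm_sub_le (isConeFit_monoCoef hB (e w))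
  have := (e.lipschitz.comp h).comp e.symm.lipschitz
  exact ⟨_, this⟩

/-- A linear left inverse of `B` recovers the coefficients from the fit. Continuity is what makes
the tie patterns measurable. -/
theorem continuous_monoCoef {B : Matrix (Fin n) (Fin J) ℝ}
    (hB : LinearIndependent ℝ B.col) : Continuous (monoCoef B) := by
  obtain ⟨C, hC⟩ := exists_lipschitzWith_monoFit hB
  obtain ⟨g, hg⟩ := B.mulVecLin.exists_leftInverse_of_injective
    (LinearMap.ker_eq_bot.2 (Matrix.mulVec_injective_iff.2 hB))
  have : monoCoef B = g ∘ monoFit B := by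
    ext1 y
    exact (LinearMap.congr_fun hg (monoCoef B y)).symm
  rw [this]
  exact (LinearMap.continuous_of_finiteDimensional g).comp hC.continuous

theorem ae_sum_lineDeriv_monoFit {B : Matrix (Fin n) (Fin J) ℝ}
    (hB : LinearIndependent ℝ B.col) : ∀ᵐ y : Fin n → ℝ,
      ∑ i, lineDeriv ℝ (fun y => monoFit B y i) y (Pi.single i 1) = numDistinctCoef B y := by
  obtain ⟨C, hC⟩ := exists_lipschitzWith_monoFit hB
  set e := EuclideanSpace.equiv (Fin n) ℝ with he
  set A : Set (Fin J × Fin J) → (Fin n → ℝ) →L[ℝ] (Fin n → ℝ) := fun s =>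
    e.toContinuousLinearMap ∘L tiedProj (euclideanMulVec B) s ∘L e.symm.toContinuousLinearMap
  have hmeas : ∀ s, MeasurableSet {y | ties (monoCoef B y) = s} := fun s => by
    have hc : ∀ j, Continuous fun y => monoCoef B y j := fun j =>
      (continuous_apply j).comp (continuous_monoCoef hB)
    have : {y | ties (monoCoef B y) = s} =
        ⋂ p : Fin J × Fin J, {y | monoCoef B y p.1 = monoCoef B y p.2 ↔ p ∈ s} := by
      ext y
      simp [Set.ext_iff, ties]
    rw [this]
    refine MeasurableSet.iInter fun p => ?_
    have hE := (isClosed_eq (hc p.1) (hc p.2)).measurableSet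
    by_cases hp : p ∈ s
    · simpa [hp] using hE
    · simp only [hp, iff_false]
      exact hE.compl
  have hpt : ∀ y, monoFit B y = A (ties (monoCoef B y)) y := fun y => by
    have := congrArg e (isConeFit_monoCoef hB y).eq_tiedProj
    exact this
  filter_upwards [hC.ae_hasFDerivAt_of_piecewise_linear volume A (fun y => ties (monoCoef B y))
    hmeas hpt] with y hy
  rw [numDistinctCoef, ← sum_inner_tiedProj (EuclideanSpace.basisFun (Fin n) ℝ)
    (euclideanMulVec_injective hB)]
  refine Finset.sum_congr rfl fun i _ => ?_
  have h1 := ((hasFDerivAt_pi'.1 hy i).hasLineDerivAt (Pi.single i 1)).lineDeriv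
  rw [h1, EuclideanSpace.basisFun_apply, EuclideanSpace.inner_single_left]
  simp only [map_one, one_mul]
  rfl

end MonoSpline

/-! ### Degrees of freedom -/

open MonoSpline in
theorem mainTheorem2 {n J : ℕ} (t : Fin (J + 4) → ℝ) (ht : Monotone t) (x : Fin n → ℝ)
    (hB : LinearIndependent ℝ (MonoSpline.splineMatrix t x).col)
    (μ : Fin n → ℝ) (σ : ℝ≥0) (hσ : 0 < σ)
    {Ω : Type*} [MeasurableSpace Ω] (P : Measure Ω) [IsProbabilityMeasure P]
    (Y : Ω → Fin n → ℝ)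
    (hY : HasLaw Y (Measure.pi fun i => gaussianReal (μ i) (σ ^ 2)) P) :
    (∀ y : Fin n → ℝ, ∃! γ : Fin J → ℝ,
      MonoSpline.IsMonotoneFit (MonoSpline.splineMatrix t x) y γ) ∧
    (∀ i, MemLp (fun ω => MonoSpline.monoFit (MonoSpline.splineMatrix t x) (Y ω) i) 2 P) ∧
    Integrable
      (fun ω => (MonoSpline.numDistinctCoef (MonoSpline.splineMatrix t x) (Y ω) : ℝ)) P ∧
    MonoSpline.degreesOfFreedom P Y σ (MonoSpline.monoFit (MonoSpline.splineMatrix t x)) =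
      ∫ ω, (MonoSpline.numDistinctCoef (MonoSpline.splineMatrix t x) (Y ω) : ℝ) ∂P := by
  set B := MonoSpline.splineMatrix t x
  have hv : σ ^ 2 ≠ 0 := (pow_pos hσ 2).ne'
  set ν := Measure.pi fun i => gaussianReal (μ i) (σ ^ 2) with hν
  obtain ⟨C, hC⟩ := exists_lipschitzWith_monoFit hB
  have hCi : ∀ i, LipschitzWith C fun y => monoFit B y i := fun i => by
    simpa [Function.comp_def] using (LipschitzWith.eval i).comp hC
  have hac : ν ≪ (volume : Measure (Fin n → ℝ)) :=
    Measure.pi_fin_absolutelyContinuous fun i => gaussianReal_absolutelyContinuous _ hv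
  -- The divergence formula holds off a Lebesgue null set, which is also null for the nondegenerate
  -- Gaussian law.
  have hae := hac.ae_le (ae_sum_lineDeriv_monoFit hB)
  have hF : ∀ i, MemLp (fun y => monoFit B y i) 2 ν := fun i =>
    memLp_of_lipschitzWith_pi_gaussianReal (hCi i) μ _
  have hE : ∀ i, MemLp (fun y : Fin n → ℝ => y i) 2 ν := fun i =>
    memLp_eval_pi_gaussianReal μ _ i
  have hD : ∀ i, Integrable
      (fun y => lineDeriv ℝ (fun y => monoFit B y i) y (Pi.single i 1)) ν := fun i =>
    integrable_lineDeriv_pi_gaussianReal (hCi i) μ _ _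
  -- The count agrees almost everywhere with a sum of integrable derivatives, which yields its
  -- measurability as well as its integrability.
  have hN : Integrable (fun y => (numDistinctCoef B y : ℝ)) ν :=
    (integrable_finsetSum _ fun i _ => hD i).congr hae
  have hcov : ∀ i, cov[fun ω => monoFit B (Y ω) i, fun ω => Y ω i; P] =
      (σ : ℝ) ^ 2 * ∫ y, lineDeriv ℝ (fun y => monoFit B y i) y (Pi.single i 1) ∂ν := fun i => by
    have hmean : ∫ y, y i ∂ν = μ i := by
      rw [hν, integral_comp_eval (μ := fun i => gaussianReal (μ i) (σ ^ 2)) (f := fun s => s)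
        (by fun_prop), integral_id_gaussianReal]
    have := integral_sub_mul_pi_gaussianReal_of_lipschitzWith (hCi i) μ hv i
    rw [NNReal.coe_pow] at this
    rw [hY.covariance_fun_comp (f := fun y => monoFit B y i) (g := fun y => y i)
      (hCi i).continuous.aemeasurable (measurable_pi_apply i).aemeasurable,
      covariance_eq_sub (hF i) (hE i), hmean, ← this]
    simp only [sub_mul]
    have hprod : Integrable (fun y => y i * monoFit B y i) ν := (hE i).integrable_mul (hF i)
    rw [integral_sub hprod (((hF i).integrable (by simp)).const_mul _),
      integral_const_mul, mul_comm (μ i)]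
    congr 2 with y
    exact mul_comm _ _
  refine ⟨existsUnique_isMonotoneFit hB, fun i => ?_, ?_, ?_⟩
  · exact (hY.map_eq ▸ hF i).comp_of_map hY.aemeasurable
  · exact (hY.map_eq ▸ hN).comp_aemeasurable hY.aemeasurable
  · have h1 := hY.integral_comp hN.aestronglyMeasurable
    rw [Function.comp_def] at h1
    rw [h1, ← integral_congr_ae hae, integral_finsetSum _ fun i _ => hD i, degreesOfFreedom]
    simp only [hcov, ← Finset.mul_sum]
    have : (σ : ℝ) ≠ 0 := by exact_mod_cast hσ.ne'
    field_simp
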